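/- All graphs are finite, simple and undirected. $C_n$ and $P_n$ denote the cycle and the path on $n$ vertices and $K_{r,s}$ the complete bipartite graph with parts of sizes $r$ and $s$; a graph is $F$-subgraph-free if it does not contain $F$ as a (not necessarily induced) subgraph. The diameter of a graph is the maximum distance between two of its vertices (infinite if the graph is disconnected). An elimination forest of a graph $G$ is a rooted forest $T$ on the vertex set $V(G)$ such that the two ends of every edge of $G$ lie on a common root-to-leaf path of $T$; the treedepth $\mathrm{td}(G)$ is the minimum height of an elimination forest of $G$, where the height is the maximum number of vertices on a root-to-leaf path. **Theorem.** The class of $C_8$-subgraph-free graphs of diameter at most $3$ has bounded treedepth: there is an integer $N$ such that $\mathrm{td}(G)\le N$ for every $C_8$-subgraph-free graph $G$ of diameter at most $3$. More precisely, call a natural number $c$ admissible if every $K_{4,4}$-subgraph-free graph of treedepth at least $c$ contains $P_{42}$ as an induced subgraph. Then admissible numbers exist, and for every admissible number $c$ (that is, for any choice of the constant $c(4,4,42)$), every $C_8$-subgraph-free graph $G$ of diameter at most $3$ satisfies $\mathrm{td}(G)<c$. -/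

import Mathlib

universe u

namespace SimpleGraph

/-- An elimination forest of a graph `G`: a rooted forest on the vertex set of `G`, given by its
parent map (`none` at the roots), such that the two ends of every edge of `G` lie on a common
root-to-leaf path, i.e. one of them is an ancestor of the other.
`depth v` is the number of vertices on the path from the root to `v`; it is determined by `parent`,
and its existence says that `parent` has no cycles. -/
structure EliminationForest {V : Type u} (G : SimpleGraph V) where
  parent : V → Option V
  depth : V → ℕ
  depth_root : ∀ v, parent v = none → depth v = 1
  depth_child : ∀ v w, parent v = some w → depth v = depth w + 1
  edge_cond : ∀ v w, G.Adj v w →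
    Relation.ReflTransGen (fun a b => parent a = some b) v w ∨
      Relation.ReflTransGen (fun a b => parent a = some b) w v

/-- The height of an elimination forest: the maximum number of vertices on a root-to-leaf path
(`0` for the empty forest). -/
noncomputable def EliminationForest.height {V : Type u} {G : SimpleGraph V}
    (T : G.EliminationForest) : ℕ∞ :=
  ⨆ v, (T.depth v : ℕ∞)

/-- The treedepth of a graph: the minimum height of an elimination forest. -/
noncomputable def treedepth {V : Type u} (G : SimpleGraph V) : ℕ∞ :=
  ⨅ T : G.EliminationForest, T.height

/-- `c` is an admissible value of the constant `c(r, s, ℓ)`: every finite `K_{r,s}`-subgraph-free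
graph of treedepth at least `c` contains the path on `ℓ` vertices as an induced subgraph. -/
def IsInducedPathBound (r s ℓ c : ℕ) : Prop :=
  ∀ (V : Type u) [Finite V] (G : SimpleGraph V),
    (completeBipartiteGraph (Fin r) (Fin s)).Free G → (c : ℕ∞) ≤ G.treedepth →
      (pathGraph ℓ).IsIndContained G

end SimpleGraph

/-! The graph $K_{4,4}$ contains $C_8$, so a $C_8$-free graph is $K_{4,4}$-free. If its treedepth
reaches an admissible $c$, it has an induced $P_{42}$. It remains to see that diameter at most $3$
and a long induced path force a $C_8$; 14 path vertices already suffice.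

Nonadjacent path vertices are joined by a connection of length two or three. For two vertices at
distance five on the path, a connection through two new vertices closes a $C_8$ at once, so only a
few connections survive. Combining the survivors for several pairs always ends in a $C_8$. This
finite case tree is evaluated by the kernel in `run_eq`, and `run_sound` transfers the outcome to
the graph.

Admissible numbers exist for two reasons. A depth-first forest bounds treedepth by the number of
vertices on a longest path (`treedepth_le_of_forall_isChain`). A graph with a long path and no
$K_{t,t}$ has a long induced path (`exists_pathGraph_isIndContained`). For the latter, number the
path. If a greedy induced path stays short, some vertex has neighbours in every window of a long
later stretch; iterating gives many such vertices for one common stretch. By Ramsey's theorem these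
vertices may be taken independent and the stretch cut into blocks that look alike to all of them and
have no edges between each other. An induced path then alternates between these vertices and fresh
blocks. -/

namespace SimpleGraph

/-! ### The case analysis as a computation on labels -/

namespace CycleSearch

/-- Adjacency of the labels of the initial path on `n` vertices. -/
def pathAdj (n u v : ℕ) : Bool :=
  Nat.blt u n && Nat.blt v n && (Nat.beq (u + 1) v || Nat.beq (v + 1) u)

/-- Adjacency of labels: along the initial path, or by one of the recorded edges. -/
def adj (n : ℕ) (E : List (ℕ × ℕ)) (u v : ℕ) : Bool :=
  pathAdj n u v ||
    E.any fun e => (Nat.beq e.1 u && Nat.beq e.2 v) || (Nat.beq e.1 v && Nat.beq e.2 u)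

/-- `k x`, arranged so that the kernel evaluates `x` first. -/
def force {α : Type} (x : ℕ) (k : ℕ → α) : α := Nat.rec (k 0) (fun p _ => k (Nat.succ p)) x

/-- `k l`, arranged so that the kernel evaluates `l` first. -/
def forceList {α : Type} : List (ℕ × ℕ) → (List (ℕ × ℕ) → α) → α
  | [], k => k []
  | e :: l, k => force e.1 fun a => force e.2 fun b => forceList l fun l => k ((a, b) :: l)

/-- A list of labels that contains the neighbours of `u`. -/
def nbrs (E : List (ℕ × ℕ)) (u : ℕ) : List ℕ :=
  (u - 1) :: (u + 1) :: E.map fun e => if Nat.beq e.1 u then e.2 else e.1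

/-- `reach n E L used u v`: some path from `u` to `v` has exactly `L` inner vertices, none of them
in `used`. -/
def reach (n : ℕ) (E : List (ℕ × ℕ)) : ℕ → List ℕ → ℕ → ℕ → Bool
  | 0, _, u, v => adj n E u v
  | L + 1, used, u, v => (nbrs E u).any fun w => force w fun w =>
      !(used.any (Nat.beq w)) && (adj n E u w && reach n E L (w :: used) w v)

/-- Two labels that may be adjacent: path labels are so only along the path. -/
def compat (n u v : ℕ) : Bool := Nat.ble n u || Nat.ble n v || pathAdj n u v

/-- Record the edges `o`. -/
def addEdges (n : ℕ) : List (ℕ × ℕ) → List (ℕ × ℕ) → List (ℕ × ℕ)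
  | E, [] => E
  | E, e :: o => addEdges n (if adj n E e.1 e.2 then E else e :: E) o

/-- The connections of length two or three between `i` and `j`, with the number of labels that are
in use afterwards. -/
def options (n m : ℕ) (E : List (ℕ × ℕ)) (i j : ℕ) : List (List (ℕ × ℕ) × ℕ) :=
  (((List.range (m + 1)).filter fun x => compat n i x && compat n x j).map
    fun x => ([(i, x), (x, j)], max m (x + 1))) ++
  -- If `x` is already joined to `j`, or below `y` to `i`, the connection shortens to one of length
  -- two, listed above.
  ((List.range (m + 1)).filter fun x => compat n i x && !adj n E x j).flatMap fun x =>
    ((List.range (max m (x + 1) + 1)).filter fun y =>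
      compat n x y && compat n y j && !adj n E i y).map
    fun y => ([(i, x), (x, y), (y, j)], max (max m (x + 1)) (y + 1))

/-- One of the edges `o` that is not among `E` closes a cycle of length eight with `E'`. -/
def dead (n : ℕ) (E E' o : List (ℕ × ℕ)) : Bool :=
  o.any fun e => !adj n E e.1 e.2 && reach n E' 6 [e.1, e.2] e.1 e.2

/-- Refute a state by branching over the connections between the first pair of the list, then of
the next one, and so on in preorder; the unused pairs are returned. -/
def run (n : ℕ) : ℕ → List (ℕ × ℕ) → ℕ → List (ℕ × ℕ) → Option (List (ℕ × ℕ))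
  | 0, _, _, _ => none
  | _ + 1, [], _, _ => none
  | k + 1, (i, j) :: ps, m, E =>
    if Nat.blt i n && Nat.blt j n && Nat.blt (i + 1) j then
      (options n m E i j).foldl (fun acc o => acc.bind fun qs =>
        forceList o.1 fun o' => forceList (addEdges n E o') fun E' =>
        if dead n E E' o' then some qs else force o.2 fun m' => run n k qs m' E') (some ps)
    else none

-- The pairs are the certificate: each inner node of the case tree takes the next pair in preorder.
-- The number 14 is the number of path vertices and initially of labels in use; 12 bounds the depth
-- of the tree.
set_option maxRecDepth 100000 in
theorem run_eq : (run 14 12 [(3,8),(5,10),(4,9),(1,7),(4,9),(5,12),(3,11),(4,11),(2,7),(3,10),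
    (1,6),(2,9),(1,6),(1,6),(2,9),(0,5),(1,8),(0,5)] 14 []).isSome = true := by
  decide +kernel

end CycleSearch
end SimpleGraph

/-! ### Soundness of the case analysis -/

namespace SimpleGraph

variable {V : Type u} {G : SimpleGraph V}

theorem cycleGraph_eight_isContained {a b c d e f g h : V}
    (hn : [a, b, c, d, e, f, g, h].Nodup)
    (hc : [a, b, c, d, e, f, g, h].IsChain G.Adj) (hl : G.Adj h a) :
    (cycleGraph 8).IsContained G := by
  have hinj : Function.Injective ![a, b, c, d, e, f, g, h] := by
    rw [← List.nodup_ofFn]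
    simpa [List.ofFn_succ] using hn
  simp only [List.isChain_cons_cons, List.isChain_singleton, and_true] at hc
  obtain ⟨h1, h2, h3, h4, h5, h6, h7⟩ := hc
  have hsucc : ∀ i : Fin 8, G.Adj (![a, b, c, d, e, f, g, h] i)
      (![a, b, c, d, e, f, g, h] (i + 1)) := by
    intro i
    fin_cases i
    exacts [h1, h2, h3, h4, h5, h6, h7, hl]
  refine ⟨⟨⟨_, fun {i j} hij => ?_⟩, hinj⟩⟩
  rcases cycleGraph_adj.1 hij with h | h
  · obtain rfl : i = j + 1 := by rw [add_comm, ← sub_eq_iff_eq_add, h]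
    exact (hsucc j).symm
  · obtain rfl : j = i + 1 := by rw [add_comm, ← sub_eq_iff_eq_add, h]
    exact hsucc i

namespace CycleSearch

theorem force_eq {α : Type} (x : ℕ) (k : ℕ → α) : force x k = k x := by
  cases x <;> rfl

theorem forceList_eq {α : Type} (l : List (ℕ × ℕ)) (k : List (ℕ × ℕ) → α) :
    forceList l k = k l := by
  induction l generalizing k with
  | nil => rfl
  | cons e l ih => simp only [forceList, force_eq, ih]

theorem pathAdj_iff {n u v : ℕ} :
    pathAdj n u v = true ↔ u < n ∧ v < n ∧ (u + 1 = v ∨ v + 1 = u) := by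
  simp [pathAdj, and_assoc]

theorem adj_iff {n : ℕ} {E : List (ℕ × ℕ)} {u v : ℕ} :
    adj n E u v = true ↔ pathAdj n u v = true ∨ (u, v) ∈ E ∨ (v, u) ∈ E := by
  simp only [adj, Bool.or_eq_true, List.any_eq_true, Bool.and_eq_true, Nat.beq_eq]
  refine or_congr_right ⟨?_, ?_⟩
  · rintro ⟨⟨x, y⟩, he, ⟨rfl, rfl⟩ | ⟨rfl, rfl⟩⟩
    exacts [.inl he, .inr he]
  · rintro (he | he)
    exacts [⟨_, he, .inl ⟨rfl, rfl⟩⟩, ⟨_, he, .inr ⟨rfl, rfl⟩⟩]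

/-- Every step is rechecked by `adj`, so nothing about `nbrs` is needed. Having `v` among the used
labels keeps the end of the path off its interior. -/
theorem reach_sound {n : ℕ} {E : List (ℕ × ℕ)} {L : ℕ} {used : List ℕ} {u v : ℕ}
    (h : reach n E L used u v = true) (hv : v ∈ used) :
    ∃ l : List ℕ, l.length = L ∧ l.Nodup ∧ (∀ w ∈ l, w ∉ used) ∧
      (u :: (l ++ [v])).IsChain fun a b => adj n E a b = true := by
  induction L generalizing used u with
  | zero => exact ⟨[], by simpa [reach] using h⟩
  | succ L ih =>
    simp only [reach, force_eq, List.any_eq_true, Bool.and_eq_true, Bool.not_eq_true',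
      List.any_eq_false, Nat.beq_eq] at h
    obtain ⟨w, -, hw, ha, hr⟩ := h
    obtain ⟨l, hl, hn, hu, hc⟩ := ih hr (List.mem_cons_of_mem _ hv)
    refine ⟨w :: l, by simp [hl], List.nodup_cons.2 ⟨fun hwl => hu w hwl (by simp), hn⟩, ?_, ?_⟩
    · intro x hx
      rcases List.mem_cons.1 hx with rfl | hx
      · exact fun hxu => hw x hxu rfl
      · exact fun hxu => hu x hx (List.mem_cons_of_mem _ hxu)
    · exact List.isChain_cons_cons.2 ⟨ha, hc⟩

variable (G) in
/-- The labels below `m` are realized by distinct vertices, those below `n` by an induced path,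
and the recorded edges by edges. -/
structure Realizes (n m : ℕ) (E : List (ℕ × ℕ)) (f : ℕ → V) : Prop where
  le : n ≤ m
  injOn : Set.InjOn f (Set.Iio m)
  path : ∀ u v, u < n → v < n → (G.Adj (f u) (f v) ↔ pathAdj n u v = true)
  edges : ∀ e ∈ E, e.1 < m ∧ e.2 < m ∧ G.Adj (f e.1) (f e.2)

namespace Realizes

variable {n m : ℕ} {E o : List (ℕ × ℕ)} {f : ℕ → V}

theorem of_adj (hf : Realizes G n m E f) {u v : ℕ} (h : adj n E u v = true) :
    u < m ∧ v < m ∧ G.Adj (f u) (f v) := by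
  rcases adj_iff.1 h with h | h | h
  · have h' := pathAdj_iff.1 h
    exact ⟨h'.1.trans_le hf.le, h'.2.1.trans_le hf.le, (hf.path u v h'.1 h'.2.1).2 h⟩
  · exact hf.edges _ h
  · obtain ⟨h1, h2, h3⟩ := hf.edges _ h
    exact ⟨h2, h1, h3.symm⟩

theorem compat (hf : Realizes G n m E f) {u v : ℕ} (h : G.Adj (f u) (f v)) :
    compat n u v = true := by
  by_cases hu : n ≤ u
  · simp [CycleSearch.compat, hu]
  by_cases hv : n ≤ v
  · simp [CycleSearch.compat, hv]
  · simp [CycleSearch.compat, (hf.path u v (by omega) (by omega)).1 h]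

theorem addEdges (hf : Realizes G n m E f)
    (ho : ∀ e ∈ o, e.1 < m ∧ e.2 < m ∧ G.Adj (f e.1) (f e.2)) :
    Realizes G n m (addEdges n E o) f := by
  induction o generalizing E with
  | nil => exact hf
  | cons e o ih =>
    refine ih ?_ fun e he => ho e (List.mem_cons_of_mem _ he)
    split
    · exact hf
    · refine ⟨hf.le, hf.injOn, hf.path, fun e' he' => ?_⟩
      rcases List.mem_cons.1 he' with rfl | he'
      · exact ho _ (by simp)
      · exact hf.edges _ he'

theorem isContained_of_dead {E₀ : List (ℕ × ℕ)} (hf : Realizes G n m E f)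
    (ho : ∀ e ∈ o, G.Adj (f e.1) (f e.2)) (h : dead n E₀ E o = true) :
    (cycleGraph 8).IsContained G := by
  simp only [dead, List.any_eq_true, Bool.and_eq_true] at h
  -- Novelty of the edge is dropped: it only saves time, since any edge closing such a path gives
  -- the cycle.
  obtain ⟨⟨u, v⟩, he, -, hr⟩ := h
  have huv : G.Adj (f u) (f v) := ho _ he
  obtain ⟨l, hl, hn, hu, hc⟩ := reach_sound hr (by simp)
  match l, hl with
  | [a, b, c, d, x, y], _ =>
    have hlt : ∀ z ∈ [u, a, b, c, d, x, y, v], z < m := by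
      simp only [List.cons_append, List.nil_append, List.isChain_cons_cons,
        List.isChain_singleton, and_true] at hc
      obtain ⟨h1, h2, h3, h4, h5, h6, h7⟩ := hc
      simp only [List.mem_cons, List.not_mem_nil, or_false, forall_eq_or_imp, forall_eq]
      exact ⟨(hf.of_adj h1).1, (hf.of_adj h2).1, (hf.of_adj h3).1, (hf.of_adj h4).1,
        (hf.of_adj h5).1, (hf.of_adj h6).1, (hf.of_adj h7).1, (hf.of_adj h7).2.1⟩
    have hnd : [u, a, b, c, d, x, y, v].Nodup := by
      have huv' : u ≠ v := fun h => huv.ne (congrArg f h)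
      have : ([u] ++ ([a, b, c, d, x, y] ++ [v])).Nodup := by
        rw [List.nodup_append, List.nodup_append]
        refine ⟨by simp, ⟨hn, by simp, ?_⟩, ?_⟩
        · rintro z hz w hw rfl
          exact hu z hz (by simp_all)
        · rintro z hz w hw rfl
          rw [List.mem_singleton.1 hz] at hw
          rcases List.mem_append.1 hw with hw | hw
          · exact hu _ hw (by simp)
          · exact huv' (List.mem_singleton.1 hw)
      exact this
    have hnd' := hnd.map_on (f := f) fun z hz w hw h => hf.injOn (hlt z hz) (hlt w hw) h
    have hc' : ([u, a, b, c, d, x, y, v].map f).IsChain G.Adj := by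
      rw [List.isChain_map]
      exact hc.imp fun _ _ h => (hf.of_adj h).2.2
    exact cycleGraph_eight_isContained hnd' hc' huv.symm

/-- Either `a` already carries a label or it receives the first free label `m`; `max m (x + 1)`
counts the labels in both cases. -/
theorem exists_label (hf : Realizes G n m E f) (a : V) :
    ∃ x f', x ≤ m ∧ f' x = a ∧ (∀ y < m, f' y = f y) ∧ Realizes G n (max m (x + 1)) E f' := by
  by_cases ha : ∃ x < m, f x = a
  · obtain ⟨x, hx, rfl⟩ := ha
    exact ⟨x, f, hx.le, rfl, fun _ _ => rfl, by rwa [max_eq_left hx]⟩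
  · push Not at ha
    have heq : ∀ y < m, Function.update f m a y = f y := fun y hy =>
      Function.update_of_ne hy.ne _ _
    refine ⟨m, Function.update f m a, le_rfl, by simp, heq, ?_⟩
    rw [max_eq_right (Nat.le_succ m)]
    refine ⟨hf.le.trans m.le_succ, ?_, fun u v hu hv => ?_, fun e he => ?_⟩
    · intro x hx y hy hxy
      simp only [Set.mem_Iio] at hx hy
      rcases Nat.lt_succ_iff_lt_or_eq.1 hx with hx | rfl <;>
        rcases Nat.lt_succ_iff_lt_or_eq.1 hy with hy | rfl
      · rw [heq x hx, heq y hy] at hxy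
        exact hf.injOn hx hy hxy
      · rw [heq x hx, Function.update_self] at hxy
        exact absurd hxy (ha x hx)
      · rw [heq y hy, Function.update_self] at hxy
        exact absurd hxy.symm (ha y hy)
      · rfl
    · rw [heq u (hu.trans_le hf.le), heq v (hv.trans_le hf.le)]
      exact hf.path u v hu hv
    · obtain ⟨h1, h2, h3⟩ := hf.edges e he
      refine ⟨h1.trans m.lt_succ_self, h2.trans m.lt_succ_self, ?_⟩
      rwa [heq _ h1, heq _ h2]

end Realizes

/-- A failure is never recovered by `bind`, so success of the fold means that every branch was
refuted, whatever pairs were left when it started. -/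
theorem of_foldl_bind_eq_some {α β : Type} {g : β → α → Option α} {l : List β} {acc : Option α}
    {r : α} (h : l.foldl (fun acc o => acc.bind (g o)) acc = some r) :
    (∃ q, acc = some q) ∧ ∀ o ∈ l, ∃ q q', g o q = some q' := by
  induction l generalizing acc with
  | nil => exact ⟨⟨r, h⟩, by simp⟩
  | cons b l ih =>
    obtain ⟨⟨q, hq⟩, hl⟩ := ih h
    obtain ⟨q', hq', hg⟩ := Option.bind_eq_some_iff.1 hq
    refine ⟨⟨q', hq'⟩, fun o ho => ?_⟩
    rcases List.mem_cons.1 ho with rfl | ho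
    · exact ⟨q', q, hg⟩
    · exact hl o ho

/-- If every two vertices are joined by a walk of length at most three and the search succeeds,
then the graph contains a cycle of length eight. -/
theorem run_sound {n k : ℕ} {ps r E : List (ℕ × ℕ)} {m : ℕ} {f : ℕ → V}
    (hd : ∀ u v : V, u ≠ v → G.Adj u v ∨ (∃ a, G.Adj u a ∧ G.Adj a v) ∨
      ∃ a b, G.Adj u a ∧ G.Adj a b ∧ G.Adj b v)
    (h : run n k ps m E = some r) (hf : Realizes G n m E f) :
    (cycleGraph 8).IsContained G := by
  induction k generalizing ps r E m f with
  | zero => simp [run] at h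
  | succ k ih =>
    match ps with
    | [] => simp [run] at h
    | (i, j) :: ps =>
      simp only [run, force_eq, forceList_eq] at h
      split at h
      swap
      · simp at h
      rename_i hij
      simp only [Bool.and_eq_true, Nat.blt_eq, and_assoc] at hij
      obtain ⟨hi, hj, hij⟩ := hij
      have hopt := (of_foldl_bind_eq_some h).2
      have key : ∀ o m' f', (o, m') ∈ options n m E i j → Realizes G n m' E f' →
          (∀ e ∈ o, e.1 < m' ∧ e.2 < m' ∧ G.Adj (f' e.1) (f' e.2)) →
          (cycleGraph 8).IsContained G := by
        intro o m' f' hmem hf' ho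
        obtain ⟨q, q', hq⟩ := hopt _ hmem
        dsimp only at hq
        split at hq
        · rename_i hdead
          exact (hf'.addEdges ho).isContained_of_dead (fun e he => (ho e he).2.2) hdead
        · exact ih hq (hf'.addEdges ho)
      have him : i < m := hi.trans_le hf.le
      have hjm : j < m := hj.trans_le hf.le
      have hne : f i ≠ f j := fun h => by have := hf.injOn him hjm h; omega
      have two : (∃ a, G.Adj (f i) a ∧ G.Adj a (f j)) → (cycleGraph 8).IsContained G := by
        rintro ⟨a, h1, h2⟩
        obtain ⟨x, f', hx, rfl, heq, hf'⟩ := hf.exists_label a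
        rw [← heq i him] at h1
        rw [← heq j hjm] at h2
        refine key [(i, x), (x, j)] _ f' ?_ hf' ?_
        · simp only [options, List.mem_append, List.mem_map, List.mem_filter, List.mem_range,
            Bool.and_eq_true]
          exact .inl ⟨x, ⟨by omega, hf'.compat h1, hf'.compat h2⟩, rfl⟩
        · simp only [List.mem_cons, List.not_mem_nil, or_false, forall_eq_or_imp, forall_eq]
          exact ⟨⟨by omega, by omega, h1⟩, by omega, by omega, h2⟩
      rcases hd _ _ hne with h1 | h1 | ⟨a, b, h1, h2, h3⟩
      · have := pathAdj_iff.1 ((hf.path i j hi hj).1 h1)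
        omega
      · exact two h1
      -- Assuming that there is no cycle rules out connections of length two, which is what the
      -- filters in `options` require of `x` and `y`.
      · by_contra hcon
        obtain ⟨x, f₁, hx, rfl, heq₁, hf₁⟩ := hf.exists_label a
        obtain ⟨y, f₂, hy, rfl, heq₂, hf₂⟩ := hf₁.exists_label b
        have h1' := h1
        have h3' := h3
        have hx₁ : x < max m (x + 1) := by omega
        rw [← heq₁ i him, ← heq₂ i (by omega), ← heq₂ x hx₁] at h1
        rw [← heq₂ x hx₁] at h2
        rw [← heq₁ j hjm, ← heq₂ j (by omega)] at h3
        refine hcon (key [(i, x), (x, y), (y, j)] _ f₂ ?_ hf₂ ?_)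
        · simp only [options, List.mem_append, List.mem_map, List.mem_filter, List.mem_range,
            Bool.and_eq_true, List.mem_flatMap, Bool.not_eq_true', ← Bool.not_eq_true]
          refine .inr ⟨x, ⟨by omega, hf₂.compat h1, fun hadj => hcon (two ⟨_, h1', ?_⟩)⟩, y,
            ⟨by omega, ⟨hf₂.compat h2, hf₂.compat h3⟩, fun hadj => hcon (two ⟨_, ?_, h3'⟩)⟩, rfl⟩
          · obtain ⟨hxm, -, hadj⟩ := hf.of_adj hadj
            rwa [← heq₁ x hxm] at hadj
          · obtain ⟨-, hym, hadj⟩ := hf.of_adj hadj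
            rwa [← heq₁ y hym, ← heq₂ y (by omega)] at hadj
        · simp only [List.mem_cons, List.not_mem_nil, or_false, forall_eq_or_imp, forall_eq]
          exact ⟨⟨by omega, by omega, h1⟩, ⟨by omega, by omega, h2⟩, by omega, by omega, h3⟩

end CycleSearch

theorem exists_walk_length_le_three (hG : G.ediam ≤ 3) (u v : V) :
    ∃ p : G.Walk u v, p.length ≤ 3 := by
  have h : G.edist u v ≤ 3 := edist_le_ediam.trans hG
  obtain ⟨p, hp⟩ := exists_walk_of_edist_ne_top (G := G) (u := u) (v := v)
    (fun h' => by simp [h'] at h)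
  refine ⟨p, ?_⟩
  rw [← hp] at h
  exact_mod_cast h

/-- A graph of diameter at most three that contains a long induced path contains `C₈`. -/
theorem cycleGraph_eight_isContained_of_ediam_le_three (hG : G.ediam ≤ 3) {ℓ : ℕ} (hℓ : 14 ≤ ℓ)
    (hP : (pathGraph ℓ).IsIndContained G) : (cycleGraph 8).IsContained G := by
  obtain ⟨φ⟩ := hP
  have hpos : 0 < ℓ := by omega
  -- The value from `ℓ` on is arbitrary; only the labels below 14 are in use.
  let f : ℕ → V := fun i => if h : i < ℓ then φ ⟨i, h⟩ else φ ⟨0, hpos⟩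
  have hf : ∀ i (h : i < ℓ), f i = φ ⟨i, h⟩ := fun i h => dif_pos h
  obtain ⟨r, hr⟩ := Option.isSome_iff_exists.1 CycleSearch.run_eq
  refine CycleSearch.run_sound (f := f) (fun u v huv => ?_) hr
    ⟨le_rfl, fun x hx y hy hxy => ?_, fun x y hx hy => ?_, by simp⟩
  · obtain ⟨p, hp⟩ := exists_walk_length_le_three hG u v
    match p, hp with
    | .nil, _ => exact absurd rfl huv
    | .cons h .nil, _ => exact .inl h
    | .cons h (.cons h' .nil), _ => exact .inr (.inl ⟨_, h, h'⟩)
    | .cons h (.cons h' (.cons h'' .nil)), _ => exact .inr (.inr ⟨_, _, h, h', h''⟩)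
    | .cons h (.cons h' (.cons h'' (.cons h''' q))), hp =>
      simp only [Walk.length_cons] at hp
      omega
  · simp only [Set.mem_Iio] at hx hy
    rw [hf x (by omega), hf y (by omega)] at hxy
    simpa using φ.injective hxy
  · rw [hf x (by omega), hf y (by omega), φ.map_adj_iff, pathGraph_adj, CycleSearch.pathAdj_iff]
    simp [hx, hy]

end SimpleGraph

/-! ### Depth-first forests and treedepth -/

namespace SimpleGraph

variable {V : Type u} {G : SimpleGraph V}

variable (G) in
/-- The graph `G` with the edges that leave or avoid `S` removed. -/
def within (S : Set V) : SimpleGraph V where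
  Adj a b := G.Adj a b ∧ a ∈ S ∧ b ∈ S
  symm := ⟨fun _ _ h => ⟨h.1.symm, h.2.2, h.2.1⟩⟩
  loopless := ⟨fun _ h => h.1.ne rfl⟩

theorem within_mono {S T : Set V} (h : S ⊆ T) : G.within S ≤ G.within T :=
  fun _ _ hab => ⟨hab.1, h hab.2.1, h hab.2.2⟩

theorem mem_of_isChain_within {S : Set V} {l : List V} {a : V} (ha : a ∈ S)
    (h : (a :: l).IsChain (G.within S).Adj) : ∀ x ∈ a :: l, x ∈ S := by
  induction l generalizing a with
  | nil => simpa using ha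
  | cons b l ih =>
    rw [List.isChain_cons_cons] at h
    intro x hx
    rcases List.mem_cons.1 hx with rfl | hx
    · exact ha
    · exact ih h.1.2.2 h.2 x hx

/-- Since `ρ` is constant along the walk, the only root on it is `r`; the vertex just before the
first visit to `r` is the required `w`. -/
theorem exists_adj_root {S : Set V} {ρ : V → V} {v r : V} (p : (G.within S).Walk v r)
    (hρ : ∀ u v, (G.within S).Reachable u v → ρ u = ρ v) (hr : ρ r = r) (hv : v ∈ S)
    (hne : ρ v ≠ v) :
    ∃ w ∈ {v ∈ S | ρ v ≠ v}, (G.within {v ∈ S | ρ v ≠ v}).Reachable v w ∧ G.Adj w r := by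
  induction p with
  | nil => exact absurd hr hne
  | @cons v x r hvx q ih =>
    by_cases hx : ρ x = x
    · have hxr : x = r := by rw [← hx, hρ x r q.reachable, hr]
      exact ⟨v, ⟨hv, hne⟩, .refl _, hxr ▸ hvx.1⟩
    · obtain ⟨w, hw, hxw, hwr⟩ := ih hr hvx.2.2 hx
      have hadj : (G.within {v ∈ S | ρ v ≠ v}).Adj v x := ⟨hvx.1, ⟨hv, hne⟩, hvx.2.2, hx⟩
      exact ⟨w, hw, hadj.reachable.trans hxw, hwr⟩

/-- A depth-first forest: if `ρ` selects a root in every component of `G[S]` and paths from the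
roots have at most `k` vertices, then `G[S]` has an elimination forest of height at most `k` with
these roots. -/
theorem exists_parent_depth (k : ℕ) (S : Set V) (ρ : V → V)
    (hρS : ∀ v ∈ S, ρ v ∈ S ∧ (G.within S).Reachable v (ρ v))
    (hρ : ∀ u v, (G.within S).Reachable u v → ρ u = ρ v)
    (hk : ∀ v ∈ S, ∀ l : List V, (ρ v :: l).Nodup → (ρ v :: l).IsChain (G.within S).Adj →
      l.length + 1 ≤ k) :
    ∃ (parent : V → Option V) (depth : V → ℕ),
      (∀ v ∈ S, ρ v = v → parent v = none ∧ depth v = 1) ∧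
      (∀ v ∈ S, ρ v ≠ v → ∃ w ∈ S, parent v = some w ∧ depth v = depth w + 1) ∧
      (∀ v ∈ S, depth v ≤ k) ∧
      (∀ v ∈ S, Relation.ReflTransGen (fun a b => parent a = some b) v (ρ v)) ∧
      ∀ u v, (G.within S).Adj u v →
        Relation.ReflTransGen (fun a b => parent a = some b) u v ∨
          Relation.ReflTransGen (fun a b => parent a = some b) v u := by
  classical
  induction k generalizing S ρ with
  | zero =>
    have hS : ∀ v, v ∉ S := fun v hv => by simpa using hk v hv [] (by simp) (by simp)
    exact ⟨fun _ => none, fun _ => 0, fun v hv => absurd hv (hS v), fun v hv => absurd hv (hS v),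
      fun v hv => absurd hv (hS v), fun v hv => absurd hv (hS v), fun v _ h => absurd h.2.1 (hS v)⟩
  | succ k ih =>
    have hρρ : ∀ v ∈ S, ρ (ρ v) = ρ v := fun v hv => (hρ _ _ (hρS v hv).2).symm
    -- Delete all roots. Each remaining component has a neighbour of its old root, which becomes its
    -- new root. Putting the old root in front of a path from the new one lengthens it by a vertex,
    -- so the induction hypothesis applies with `k`.
    set S' : Set V := {v ∈ S | ρ v ≠ v} with hS'
    have hsub : S' ⊆ S := fun v hv => hv.1
    have hex : ∀ v ∈ S', ∃ w, (G.within S').connectedComponentMk w =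
        (G.within S').connectedComponentMk v ∧ w ∈ S' ∧ G.Adj w (ρ w) := by
      intro v hv
      obtain ⟨p⟩ := (hρS v hv.1).2
      obtain ⟨w, hw, hvw, hwr⟩ := exists_adj_root p hρ (hρρ v hv.1) hv.1 hv.2
      refine ⟨w, ConnectedComponent.sound hvw.symm, hw, ?_⟩
      rwa [← hρ _ _ (hvw.mono (within_mono hsub))]
    -- Choosing per component makes `ρ'` constant on components. The default is only met on
    -- components outside `S'`.
    let root : (G.within S').ConnectedComponent → V := fun c =>
      if h : ∃ w, (G.within S').connectedComponentMk w = c ∧ w ∈ S' ∧ G.Adj w (ρ w) then h.choose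
      else Quot.out c
    let ρ' : V → V := fun v => root ((G.within S').connectedComponentMk v)
    have hρ'spec : ∀ v ∈ S', (G.within S').Reachable v (ρ' v) ∧ ρ' v ∈ S' ∧
        G.Adj (ρ' v) (ρ v) := by
      intro v hv
      have h := hex v hv
      have hroot : ρ' v = h.choose := dif_pos h
      obtain ⟨h1, h2, h3⟩ := h.choose_spec
      rw [← hroot] at h1 h2 h3
      have hreach := (ConnectedComponent.exact h1).symm
      refine ⟨hreach, h2, ?_⟩
      rwa [hρ _ _ (hreach.mono (within_mono hsub))]
    have hρ' : ∀ u v, (G.within S').Reachable u v → ρ' u = ρ' v := fun u v h =>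
      congrArg root (ConnectedComponent.sound h)
    have hρρ' : ∀ v ∈ S', ρ' (ρ' v) = ρ' v := fun v hv => (hρ' _ _ (hρ'spec v hv).1).symm
    have hρeq : ∀ v ∈ S', ρ (ρ' v) = ρ v := fun v hv =>
      (hρ _ _ ((hρ'spec v hv).1.mono (within_mono hsub))).symm
    obtain ⟨par, dep, hroot, hchild, hdep, hanc, hedge⟩ := ih S' ρ'
      (fun v hv => ⟨(hρ'spec v hv).2.1, (hρ'spec v hv).1⟩) hρ' (by
        intro v hv l hn hc
        obtain ⟨-, hmem, hadj⟩ := hρ'spec v hv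
        have hall := mem_of_isChain_within hmem hc
        have := hk v hv.1 (ρ' v :: l)
          (List.nodup_cons.2 ⟨fun h => (hall _ h).2 (hρρ v hv.1), hn⟩)
          (List.isChain_cons_cons.2 ⟨⟨hadj.symm, (hρS v hv.1).1, hmem.1⟩,
            hc.imp fun a b hab => within_mono hsub hab⟩)
        simpa using this)
    -- The new roots are hung below the old ones.
    let parent : V → Option V := fun v =>
      if ρ v = v then none else if ρ' v = v then some (ρ v) else par v
    let depth : V → ℕ := fun v => if ρ v = v then 1 else dep v + 1
    have hparent : ∀ v ∈ S', ∀ w, par v = some w → parent v = some w ∧ w ∈ S' := by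
      intro v hv w hw
      have hne : ρ' v ≠ v := fun h => by simp [(hroot v hv h).1] at hw
      obtain ⟨x, hx, hpx, -⟩ := hchild v hv hne
      obtain rfl : x = w := by simpa [hpx] using hw
      exact ⟨by simp [parent, hv.2, hne, hw], hx⟩
    have hlift : ∀ u v, u ∈ S' → Relation.ReflTransGen (fun a b => par a = some b) u v →
        Relation.ReflTransGen (fun a b => parent a = some b) u v ∧ v ∈ S' := by
      intro u v hu h
      induction h with
      | refl => exact ⟨.refl, hu⟩
      | tail _ hbc ih =>
        obtain ⟨h1, h2⟩ := hparent _ ih.2 _ hbc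
        exact ⟨ih.1.tail h1, h2⟩
    have hup : ∀ v ∈ S, Relation.ReflTransGen (fun a b => parent a = some b) v (ρ v) := by
      intro v hv
      by_cases h : ρ v = v
      · rw [h]
      · have hv' : v ∈ S' := ⟨hv, h⟩
        obtain ⟨-, hmem, -⟩ := hρ'spec v hv'
        refine (hlift _ _ hv' (hanc v hv')).1.tail ?_
        simp only [parent, if_neg hmem.2, hρρ' v hv', if_true, hρeq v hv']
    refine ⟨parent, depth, fun v _ h => by simp [parent, depth, h], fun v hv h => ?_,
      fun v hv => ?_, hup, fun u v huv => ?_⟩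
    · have hv' : v ∈ S' := ⟨hv, h⟩
      by_cases h' : ρ' v = v
      · refine ⟨ρ v, (hρS v hv).1, by simp [parent, h, h'], ?_⟩
        simp [depth, h, hρρ v hv, (hroot v hv' h').2]
      · obtain ⟨w, hw, hpw, hdw⟩ := hchild v hv' h'
        exact ⟨w, hw.1, by simp [parent, h, h', hpw], by simp [depth, h, hw.2, hdw]⟩
    · by_cases h : ρ v = v
      · simp [depth, h]
      · simpa [depth, h] using hdep v ⟨hv, h⟩
    · have hrho := hρ _ _ huv.reachable
      by_cases hu : ρ u = u
      · right
        have := hup v huv.2.2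
        rwa [← hrho, hu] at this
      by_cases hv : ρ v = v
      · left
        have := hup u huv.2.1
        rwa [hrho, hv] at this
      have hu' : u ∈ S' := ⟨huv.2.1, hu⟩
      have hv' : v ∈ S' := ⟨huv.2.2, hv⟩
      exact (hedge u v ⟨huv.1, hu', hv'⟩).imp (fun h => (hlift _ _ hu' h).1)
        fun h => (hlift _ _ hv' h).1

/-- The treedepth is at most the number of vertices on a longest path. -/
theorem treedepth_le_of_forall_isChain {k : ℕ}
    (h : ∀ l : List V, l.Nodup → l.IsChain G.Adj → l.length ≤ k) : G.treedepth ≤ k := by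
  let ρ : V → V := fun v => Quot.out ((G.within Set.univ).connectedComponentMk v)
  have hρ : ∀ u v, (G.within Set.univ).Reachable u v → ρ u = ρ v := fun u v huv =>
    congrArg Quot.out (ConnectedComponent.sound huv)
  obtain ⟨parent, depth, hroot, hchild, hdep, -, hedge⟩ :=
    exists_parent_depth (G := G) k Set.univ ρ
      (fun v _ => ⟨trivial, (ConnectedComponent.exact (Quot.out_eq _)).symm⟩) hρ
      (fun v _ l hn hc => by simpa using h _ hn (hc.imp fun a b hab => hab.1))
  let T : G.EliminationForest :=
    { parent := parent
      depth := depth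
      depth_root := fun v hv => by
        by_cases hr : ρ v = v
        · exact (hroot v trivial hr).2
        · obtain ⟨w, -, hw, -⟩ := hchild v trivial hr
          simp [hv] at hw
      depth_child := fun v w hv => by
        by_cases hr : ρ v = v
        · simp [(hroot v trivial hr).1] at hv
        · obtain ⟨x, -, hx, hd⟩ := hchild v trivial hr
          obtain rfl : x = w := by simpa [hx] using hv
          exact hd
      edge_cond := fun v w hvw => hedge v w ⟨hvw, trivial, trivial⟩ }
  refine (iInf_le _ T).trans (iSup_le fun v => ?_)
  exact_mod_cast hdep v trivial

end SimpleGraph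

/-! ### Induced paths and Ramsey's theorem for pairs -/

namespace SimpleGraph

variable {V : Type u} {G : SimpleGraph V}

variable (G) in
/-- The list is the vertex sequence of an induced path. -/
def IsIndPath : List V → Prop
  | [] => True
  | a :: l => (∀ b ∈ l.head?, G.Adj a b) ∧ (∀ c ∈ l.tail, c ≠ a ∧ ¬ G.Adj a c) ∧ IsIndPath l

theorem isIndPath_singleton (a : V) : G.IsIndPath [a] := by simp [IsIndPath]

theorem isIndPath_cons_cons {a b : V} {l : List V} :
    G.IsIndPath (a :: b :: l) ↔
      G.Adj a b ∧ (∀ c ∈ l, c ≠ a ∧ ¬ G.Adj a c) ∧ G.IsIndPath (b :: l) := by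
  simp [IsIndPath]

namespace IsIndPath

theorem tail {a : V} {l : List V} (h : G.IsIndPath (a :: l)) : G.IsIndPath l := h.2.2

theorem notMem {a : V} {l : List V} (h : G.IsIndPath (a :: l)) : a ∉ l := by
  cases l with
  | nil => simp
  | cons b l =>
    obtain ⟨hab, hc, -⟩ := isIndPath_cons_cons.1 h
    rintro (_ | ⟨_, ha⟩)
    · exact hab.ne rfl
    · exact (hc a ha).1 rfl

theorem take {l : List V} (h : G.IsIndPath l) (k : ℕ) : G.IsIndPath (l.take k) := by
  induction l generalizing k with
  | nil => simpa using h
  | cons a l ih =>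
    cases k with
    | zero => simp [IsIndPath]
    | succ k =>
      rw [List.take_succ_cons]
      cases l with
      | nil => simpa using h
      | cons b l =>
        cases k with
        | zero => simpa using isIndPath_singleton a
        | succ k =>
          obtain ⟨hab, hc, hl⟩ := isIndPath_cons_cons.1 h
          rw [List.take_succ_cons, isIndPath_cons_cons]
          exact ⟨hab, fun c hcl => hc c (List.mem_of_mem_take hcl), by simpa using ih hl (k + 1)⟩

theorem append {l₁ l₂ : List V} {a : V} (h₁ : G.IsIndPath (l₁ ++ [a])) (h₂ : G.IsIndPath (a :: l₂))
    (h : ∀ x ∈ l₁, ∀ y ∈ l₂, y ≠ x ∧ ¬ G.Adj x y) : G.IsIndPath (l₁ ++ a :: l₂) := by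
  induction l₁ with
  | nil => exact h₂
  | cons b l₁ ih =>
    have ih' := ih h₁.tail fun x hx => h x (List.mem_cons_of_mem _ hx)
    cases l₁ with
    | nil =>
      exact isIndPath_cons_cons.2 ⟨(isIndPath_cons_cons.1 h₁).1, h b (by simp), ih'⟩
    | cons c l₁ =>
      obtain ⟨hbc, hb, -⟩ := isIndPath_cons_cons.1 h₁
      refine isIndPath_cons_cons.2 ⟨hbc, fun d hd => ?_, ih'⟩
      rcases List.mem_append.1 hd with hd | hd
      · exact hb d (List.mem_append_left _ hd)
      rcases List.mem_cons.1 hd with rfl | hd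
      · exact hb d (List.mem_append_right _ (by simp))
      · exact h b (by simp) d hd

theorem exists_adj {a b : V} {l : List V} (h : G.IsIndPath (a :: b :: l)) :
    ∀ x ∈ a :: b :: l, ∃ y, G.Adj x y := by
  induction l generalizing a b with
  | nil =>
    have hab := (isIndPath_cons_cons.1 h).1
    simp only [List.mem_cons, List.not_mem_nil, or_false, forall_eq_or_imp, forall_eq]
    exact ⟨⟨b, hab⟩, a, hab.symm⟩
  | cons c l ih =>
    intro x hx
    rcases List.mem_cons.1 hx with rfl | hx
    · exact ⟨b, (isIndPath_cons_cons.1 h).1⟩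
    · exact ih h.tail x hx

theorem map {W : Type*} {H : SimpleGraph W} {l : List W} (h : H.IsIndPath l) (g : W → V)
    (hinj : ∀ x ∈ l, ∀ y ∈ l, g x = g y → x = y)
    (hadj : ∀ x ∈ l, ∀ y ∈ l, (G.Adj (g x) (g y) ↔ H.Adj x y)) : G.IsIndPath (l.map g) := by
  induction l with
  | nil => simp [IsIndPath]
  | cons a l ih =>
    have ih' := ih h.tail (fun x hx y hy => hinj x (by simp [hx]) y (by simp [hy]))
      (fun x hx y hy => hadj x (by simp [hx]) y (by simp [hy]))
    cases l with
    | nil => exact isIndPath_singleton _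
    | cons b l =>
      obtain ⟨hab, hc, -⟩ := isIndPath_cons_cons.1 h
      rw [List.map_cons, List.map_cons, isIndPath_cons_cons]
      refine ⟨(hadj a (by simp) b (by simp)).2 hab, fun c hcl => ?_, ih'⟩
      obtain ⟨d, hd, rfl⟩ := List.mem_map.1 hcl
      obtain ⟨h1, h2⟩ := hc d hd
      exact ⟨fun h => h1 (hinj d (by simp [hd]) a (by simp) h),
        fun h => h2 ((hadj a (by simp) d (by simp [hd])).1 h)⟩

theorem getElem {l : List V} (h : G.IsIndPath l) {i j : ℕ} (hij : i < j) (hj : j < l.length) :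
    l[i] ≠ l[j] ∧ (G.Adj l[i] l[j] ↔ i + 1 = j) := by
  induction l generalizing i j with
  | nil => simp at hj
  | cons a l ih =>
    obtain ⟨j, rfl⟩ : ∃ j', j = j' + 1 := ⟨j - 1, by omega⟩
    cases i with
    | succ i =>
      simpa using ih h.tail (i := i) (j := j) (by omega) (by simpa using hj)
    | zero =>
      have hj' : j < l.length := by simpa using hj
      refine ⟨fun h' => h.notMem ?_, ?_⟩
      · simp only [List.getElem_cons_zero, List.getElem_cons_succ] at h'
        rw [h']
        exact List.getElem_mem _
      · cases l with
        | nil => simp at hj'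
        | cons b l =>
          obtain ⟨hab, hc, -⟩ := isIndPath_cons_cons.1 h
          cases j with
          | zero => simpa using hab
          | succ j =>
            have hjl : j < l.length := by simpa using hj'
            have := (hc l[j] (List.getElem_mem _)).2
            simpa using this

theorem isIndContained {l : List V} (h : G.IsIndPath l) :
    (pathGraph l.length).IsIndContained G := by
  refine ⟨⟨⟨fun i => l[i], fun i j hij => ?_⟩, fun {i j} => ?_⟩⟩
  · rcases lt_trichotomy i j with h' | h' | h'
    · exact absurd hij (h.getElem h' j.2).1
    · exact h'
    · exact absurd hij.symm (h.getElem h' i.2).1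
  · rw [pathGraph_adj]
    rcases lt_trichotomy i j with h' | rfl | h'
    · have h1 := (h.getElem h' j.2).2
      have h2 : (i : ℕ) < j := h'
      refine h1.trans ?_
      omega
    · simp
    · have h1 := (h.getElem h' i.2).2
      have h2 : (j : ℕ) < i := h'
      refine (G.adj_comm _ _).trans (h1.trans ?_)
      omega

/-- Enter the path at the last vertex that equals `u` or is adjacent to it, and drop everything
before. -/
theorem exists_cons {l : List V} {u b : V} (h : G.IsIndPath l) (hb : l.getLast? = some b)
    (hu : ∃ y ∈ l, y = u ∨ G.Adj u y) :
    ∃ l', G.IsIndPath l' ∧ l'.head? = some u ∧ l'.getLast? = some b ∧ ∀ x ∈ l', x = u ∨ x ∈ l := by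
  induction l with
  | nil => simp at hb
  | cons x l ih =>
    by_cases hl : ∃ y ∈ l, y = u ∨ G.Adj u y
    · have hne : l ≠ [] := by rintro rfl; simp at hl
      obtain ⟨l', h1, h2, h3, h4⟩ := ih h.tail
        (by rwa [List.getLast?_cons_of_ne_nil hne] at hb) hl
      exact ⟨l', h1, h2, h3, fun z hz => (h4 z hz).imp_right (List.mem_cons_of_mem _)⟩
    · push Not at hl
      obtain ⟨y, hy, hyu⟩ := hu
      have hyx : y = x := by
        rcases List.mem_cons.1 hy with hy | hy
        · exact hy
        · rcases hyu with hyu | hyu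
          exacts [absurd hyu (hl y hy).1, absurd hyu (hl y hy).2]
      subst hyx
      rcases hyu with rfl | hyu
      · exact ⟨y :: l, h, rfl, hb, fun z hz => .inr hz⟩
      · refine ⟨u :: y :: l, isIndPath_cons_cons.2 ⟨hyu, fun c hc => hl c hc, h⟩, rfl, ?_,
          fun z hz => List.mem_cons.1 hz⟩
        rwa [List.getLast?_cons_of_ne_nil (by simp)]

end IsIndPath

theorem exists_isIndPath_of_walk {S : Set V} {a b : V} (p : (G.within S).Walk a b) (ha : a ∈ S) :
    ∃ l, G.IsIndPath l ∧ l.head? = some a ∧ l.getLast? = some b ∧ ∀ x ∈ l, x ∈ S := by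
  induction p with
  | nil => exact ⟨[_], isIndPath_singleton _, rfl, rfl, by simpa using ha⟩
  | @cons a c b hac q ih =>
    obtain ⟨l, h1, h2, h3, h4⟩ := ih hac.2.2
    obtain ⟨l', h1', h2', h3', h4'⟩ := h1.exists_cons (u := a) h3
      ⟨c, List.mem_of_mem_head? h2, .inr hac.1⟩
    refine ⟨l', h1', h2', h3', fun x hx => ?_⟩
    rcases h4' x hx with rfl | hx
    exacts [ha, h4 x hx]

/-- Ramsey's theorem for pairs, with the colour depending on the smaller element only. -/
theorem exists_endHomogeneous (κ : Type) [Finite κ] (h : ℕ) :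
    ∃ K, ∀ (c : ℕ → ℕ → κ) (S : Finset ℕ), K ≤ S.card →
      ∃ T ⊆ S, T.card = h ∧ ∃ d : ℕ → κ, ∀ a ∈ T, ∀ b ∈ T, a < b → c a b = d a := by
  classical
  have := Fintype.ofFinite κ
  induction h with
  | zero => exact ⟨0, fun c S _ => ⟨∅, by simp, rfl, fun a => c a a, by simp⟩⟩
  | succ h ih =>
    obtain ⟨K, hK⟩ := ih
    refine ⟨Fintype.card κ * K + 1, fun c S hS => ?_⟩
    have hne : S.Nonempty := Finset.card_pos.1 (by omega)
    set m := S.min' hne with hm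
    have hmS : m ∈ S := S.min'_mem hne
    obtain ⟨k, -, hk⟩ := Finset.exists_le_card_fiber_of_mul_le_card_of_maps_to
      (s := S.erase m) (t := (Finset.univ : Finset κ)) (f := c m) (n := K)
      (fun _ _ => Finset.mem_univ _) ⟨c m m, Finset.mem_univ _⟩
      (by rw [Finset.card_erase_of_mem hmS, Finset.card_univ]; omega)
    obtain ⟨T, hT, hTc, d, hd⟩ := hK c _ hk
    have hTS : ∀ x ∈ T, x ∈ S ∧ m < x ∧ c m x = k := fun x hx => by
      have := Finset.mem_filter.1 (hT hx)
      have hxS := Finset.mem_of_mem_erase this.1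
      exact ⟨hxS, lt_of_le_of_ne (S.min'_le x hxS) (Finset.ne_of_mem_erase this.1).symm, this.2⟩
    have hmT : m ∉ T := fun h => (hTS m h).2.1.false
    refine ⟨insert m T, ?_, by rw [Finset.card_insert_of_notMem hmT, hTc],
      Function.update d m k, ?_⟩
    · intro x hx
      rcases Finset.mem_insert.1 hx with rfl | hx
      exacts [hmS, (hTS x hx).1]
    · intro a ha b hb hab
      rcases Finset.mem_insert.1 ha with rfl | haT
      · rcases Finset.mem_insert.1 hb with rfl | hbT
        · exact absurd hab (lt_irrefl _)
        · simpa using (hTS b hbT).2.2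
      · rcases Finset.mem_insert.1 hb with rfl | hbT
        · exact absurd hab (hTS a haT).2.1.not_gt
        · rw [Function.update_of_ne (hTS a haT).2.1.ne']
          exact hd a haT b hbT hab

/-- Ramsey's theorem for pairs. -/
theorem exists_homogeneous (κ : Type) [Finite κ] (h : ℕ) :
    ∃ K, ∀ (c : ℕ → ℕ → κ) (S : Finset ℕ), K ≤ S.card →
      ∃ T ⊆ S, T.card = h ∧ ∃ k, ∀ a ∈ T, ∀ b ∈ T, a < b → c a b = k := by
  classical
  have := Fintype.ofFinite κ
  obtain ⟨K, hK⟩ := exists_endHomogeneous κ (Fintype.card κ * h)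
  -- The extra one makes `S` nonempty, so that a colour exists for the pigeonhole argument.
  refine ⟨K + 1, fun c S hS => ?_⟩
  obtain ⟨T, hT, hTc, d, hd⟩ := hK c S (by omega)
  obtain ⟨x, -⟩ := Finset.card_pos.1 (show 0 < S.card by omega)
  obtain ⟨k, -, hk⟩ := Finset.exists_le_card_fiber_of_mul_le_card_of_maps_to
    (s := T) (t := (Finset.univ : Finset κ)) (f := d) (n := h)
    (fun _ _ => Finset.mem_univ _) ⟨d x, Finset.mem_univ _⟩
    (by rw [Finset.card_univ]; omega)
  obtain ⟨T', hT', hc⟩ := Finset.exists_subset_card_eq hk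
  refine ⟨T', fun x hx => hT (Finset.mem_filter.1 (hT' hx)).1, hc, k, fun a ha b hb hab => ?_⟩
  obtain ⟨ha1, ha2⟩ := Finset.mem_filter.1 (hT' ha)
  rw [hd a ha1 b (Finset.mem_filter.1 (hT' hb)).1 hab, ha2]

/-- Peel off the minimum and the maximum repeatedly. This turns a colour shared by all increasing
pairs into a complete bipartite pattern. -/
theorem exists_lower_upper (t : ℕ) (T : Finset ℕ) (h : 2 * t ≤ T.card) :
    ∃ A ⊆ T, ∃ B ⊆ T, A.card = t ∧ B.card = t ∧ ∀ a ∈ A, ∀ b ∈ B, a < b := by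
  classical
  induction t generalizing T with
  | zero => exact ⟨∅, by simp, ∅, by simp, by simp⟩
  | succ t ih =>
    have hne : T.Nonempty := Finset.card_pos.1 (by omega)
    have hlt : T.min' hne < T.max' hne := T.min'_lt_max'_of_card (by omega)
    set m := T.min' hne
    set M := T.max' hne
    have hm : m ∈ T := T.min'_mem hne
    have hM : M ∈ T := T.max'_mem hne
    have hM' : M ∈ T.erase m := Finset.mem_erase.2 ⟨hlt.ne', hM⟩
    obtain ⟨A, hA, B, hB, hAc, hBc, hAB⟩ := ih ((T.erase m).erase M) (by
      rw [Finset.card_erase_of_mem hM', Finset.card_erase_of_mem hm]; omega)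
    have key : ∀ x ∈ (T.erase m).erase M, x ∈ T ∧ m < x ∧ x < M := fun x hx => by
      obtain ⟨h1, h2⟩ := Finset.mem_erase.1 hx
      obtain ⟨h3, h4⟩ := Finset.mem_erase.1 h2
      exact ⟨h4, lt_of_le_of_ne (T.min'_le x h4) h3.symm, lt_of_le_of_ne (T.le_max' x h4) h1⟩
    refine ⟨insert m A, ?_, insert M B, ?_, ?_, ?_, ?_⟩
    · exact Finset.insert_subset hm fun x hx => (key x (hA hx)).1
    · exact Finset.insert_subset hM fun x hx => (key x (hB hx)).1
    · rw [Finset.card_insert_of_notMem fun h => (key m (hA h)).2.1.false, hAc]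
    · rw [Finset.card_insert_of_notMem fun h => (key M (hB h)).2.2.false, hBc]
    · intro a ha b hb
      rcases Finset.mem_insert.1 ha with rfl | ha <;> rcases Finset.mem_insert.1 hb with rfl | hb
      · exact hlt
      · exact (key b (hB hb)).2.1
      · exact (key a (hA ha)).2.2
      · exact hAB a ha b hb

end SimpleGraph

/-! ### Vertices with neighbours all along a stretch of the path -/

namespace SimpleGraph

variable {H : SimpleGraph ℕ}

variable (H) in
/-- The `n` consecutive numbers from `a` on form a path. -/
def PathOn (a n : ℕ) : Prop := ∀ i, a ≤ i → i + 1 < a + n → H.Adj i (i + 1)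

variable (H) in
/-- Among any `L` consecutive numbers of the `n` numbers from `a` on there is a neighbour of `x`. -/
def DenseOn (x a n L : ℕ) : Prop :=
  ∀ b, a ≤ b → b + L ≤ a + n → ∃ y, b ≤ y ∧ y < b + L ∧ H.Adj x y

theorem PathOn.mono {a n b m : ℕ} (h : H.PathOn a n) (hab : a ≤ b) (hbm : b + m ≤ a + n) :
    H.PathOn b m := fun i hi hi' => h i (by omega) (by omega)

theorem DenseOn.mono {x a n b m L L' : ℕ} (h : H.DenseOn x a n L) (hab : a ≤ b)
    (hbm : b + m ≤ a + n) (hL : L ≤ L') : H.DenseOn x b m L' := fun c hc hc' => by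
  obtain ⟨y, hy, hy', hxy⟩ := h c (by omega) (by omega)
  exact ⟨y, hy, by omega, hxy⟩

/-- If `a` misses a window of `N + 1` numbers, let `c` be its last neighbour before the window. From
`c` to the end of the window there are more than `N` numbers, and `a` sees only `c` among them. So
`a` can be put before an induced path that starts at `c`. -/
theorem exists_isIndPath_or_denseOn (f : ℕ → ℕ) (k : ℕ) :
    ∃ N, ∀ (H : SimpleGraph ℕ) (a n : ℕ), H.PathOn a n → N < n →
      (∃ l, H.IsIndPath (a :: l) ∧ l.length = k ∧ ∀ z ∈ l, a ≤ z ∧ z < a + n) ∨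
      ∃ x b m L, a ≤ x ∧ x < b ∧ b + m ≤ a + n ∧ f L ≤ m ∧ H.DenseOn x b m L := by
  induction k with
  | zero => exact ⟨0, fun H a n _ _ => .inl ⟨[], isIndPath_singleton a, rfl, by simp⟩⟩
  | succ k ih =>
    obtain ⟨N, hN⟩ := ih
    refine ⟨f (N + 1) + 1, fun H a n hP hn => ?_⟩
    by_cases hD : H.DenseOn a (a + 1) (n - 1) (N + 1)
    · exact .inr ⟨a, a + 1, n - 1, N + 1, le_rfl, by omega, by omega, by omega, hD⟩
    simp only [DenseOn, not_forall, not_exists, not_and] at hD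
    obtain ⟨b, hab, hbn, hb⟩ := hD
    have ha1 : H.Adj a (a + 1) := hP a le_rfl (by omega)
    have hb1 : a + 1 < b := by
      by_contra h
      exact hb (a + 1) (by omega) (by omega) ha1
    classical
    -- Here `d` counts backwards from the window, so the least `d` gives the last neighbour.
    have hex : ∃ d, d < b ∧ H.Adj a (b - 1 - d) := ⟨b - 1 - (a + 1), by omega, by
      rwa [show b - 1 - (b - 1 - (a + 1)) = a + 1 by omega]⟩
    obtain ⟨hd, hd'⟩ := Nat.find_spec hex
    have hmin : ∀ y, b - 1 - Nat.find hex < y → y < b → ¬ H.Adj a y := fun y hy hyb hay =>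
      Nat.find_min hex (m := b - 1 - y) (by omega)
        ⟨by omega, by rwa [show b - 1 - (b - 1 - y) = y by omega]⟩
    have hfind : Nat.find hex ≤ b - 1 - (a + 1) := Nat.find_min' hex ⟨by omega, by
      rwa [show b - 1 - (b - 1 - (a + 1)) = a + 1 by omega]⟩
    set c := b - 1 - Nat.find hex with hc
    rcases hN H c (b + (N + 1) - c) (hP.mono (by omega) (by omega)) (by omega) with
      ⟨l, hl, hlen, hlz⟩ | ⟨x, b', m, L, h1, h2, h3, h4, h5⟩
    · refine .inl ⟨c :: l, isIndPath_cons_cons.2 ⟨hd', fun z hz => ?_, hl⟩, by simp [hlen], ?_⟩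
      · obtain ⟨hz1, hz2⟩ := hlz z hz
        have hzc : z ≠ c := fun h => hl.notMem (h ▸ hz)
        refine ⟨by omega, ?_⟩
        by_cases hzb : z < b
        · exact hmin z (by omega) hzb
        · exact hb z (by omega) (by omega)
      · intro z hz
        rcases List.mem_cons.1 hz with rfl | hz
        · omega
        · have := hlz z hz
          omega
    · exact .inr ⟨x, b', m, L, by omega, h2, by omega, h4, h5⟩

theorem exists_denseOn (ℓ : ℕ) (f : ℕ → ℕ) :
    ∃ N, ∀ (H : SimpleGraph ℕ) (a n : ℕ), (∀ l, H.IsIndPath l → l.length < ℓ) →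
      H.PathOn a n → N < n →
      ∃ x b m L, a ≤ x ∧ x < b ∧ b + m ≤ a + n ∧ f L ≤ m ∧ H.DenseOn x b m L := by
  obtain ⟨N, hN⟩ := exists_isIndPath_or_denseOn f ℓ
  refine ⟨N, fun H a n hH hP hn => (hN H a n hP hn).resolve_left ?_⟩
  rintro ⟨l, hl, hlen, -⟩
  have := hH _ hl
  simp only [List.length_cons] at this
  omega

/-- Each new vertex is found inside the stretch of the earlier ones, hence differs from them. The
window length is known only afterwards, so the required length is a function `f` of it. -/
theorem exists_finset_denseOn (ℓ M : ℕ) (f : ℕ → ℕ) :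
    ∃ N, ∀ (H : SimpleGraph ℕ) (a n : ℕ), (∀ l, H.IsIndPath l → l.length < ℓ) →
      H.PathOn a n → N < n →
      ∃ (X : Finset ℕ) (b m L : ℕ), X.card = M ∧ a ≤ b ∧ b + m ≤ a + n ∧ f L ≤ m ∧
        ∀ x ∈ X, x < b ∧ H.DenseOn x b m L := by
  classical
  induction M generalizing f with
  | zero =>
    exact ⟨f 0, fun H a n _ _ hn => ⟨∅, a, n, 0, rfl, le_rfl, le_rfl, hn.le, by simp⟩⟩
  | succ M ih =>
    -- Old and new vertices share the larger of their window lengths.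
    choose N₁ hN₁ using fun L' => exists_denseOn ℓ fun L => f (max L L')
    obtain ⟨N, hN⟩ := ih fun L' => N₁ L' + 1
    refine ⟨N, fun H a n hH hP hn => ?_⟩
    obtain ⟨X, b', m', L', hX, hab, hbm, hm, hd⟩ := hN H a n hH hP hn
    obtain ⟨x, b, m, L, hx, hxb, hbm', hfm, hxd⟩ :=
      hN₁ L' H b' m' hH (hP.mono hab hbm) (by omega)
    refine ⟨insert x X, b, m, max L L', ?_, by omega, by omega, hfm, fun y hy => ?_⟩
    · rw [Finset.card_insert_of_notMem fun h => ?_, hX]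
      have := (hd x h).1
      omega
    · rcases Finset.mem_insert.1 hy with rfl | hy
      · exact ⟨hxb, hxd.mono le_rfl le_rfl (le_max_left _ _)⟩
      · obtain ⟨h1, h2⟩ := hd y hy
        exact ⟨by omega, h2.mono (by omega) hbm' (le_max_right _ _)⟩

end SimpleGraph

/-! ### Independent vertices and uniform blocks -/

namespace SimpleGraph

variable {H : SimpleGraph ℕ}

variable (H) in
/-- There is no complete bipartite subgraph with two parts of size `t`. -/
def NoBiclique (t : ℕ) : Prop :=
  ∀ S T : Finset ℕ, S.card = t → T.card = t → ∃ a ∈ S, ∃ b ∈ T, ¬ H.Adj a b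

/-- By Ramsey's theorem there is a large homogeneous set; it cannot be a clique, because `2 * t`
vertices of a clique contain the forbidden biclique. -/
theorem exists_independent (t M : ℕ) :
    ∃ R, ∀ (H : SimpleGraph ℕ), H.NoBiclique t → ∀ X : Finset ℕ, R ≤ X.card →
      ∃ X' ⊆ X, X'.card = M ∧ ∀ x ∈ X', ∀ y ∈ X', ¬ H.Adj x y := by
  obtain ⟨R, hR⟩ := exists_homogeneous Prop (M + 2 * t)
  refine ⟨R, fun H hH X hX => ?_⟩
  obtain ⟨T, hT, hTc, k, hk⟩ := hR H.Adj X hX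
  have hkf : ¬ k := by
    intro hk'
    obtain ⟨A, hA, B, hB, hAc, hBc, hAB⟩ := exists_lower_upper t T (by omega)
    obtain ⟨a, ha, b, hb, hab⟩ := hH A B hAc hBc
    exact hab ((hk a (hA ha) b (hB hb) (hAB a ha b hb)).symm ▸ hk')
  obtain ⟨X', hX', hc⟩ := Finset.exists_subset_card_eq (show M ≤ T.card by omega)
  refine ⟨X', hX'.trans hT, hc, fun x hx y hy hxy => ?_⟩
  rcases lt_trichotomy x y with h | rfl | h
  · exact hkf (hk x (hX' hx) y (hX' hy) h ▸ hxy)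
  · exact hxy.ne rfl
  · exact hkf (hk y (hX' hy) x (hX' hx) h ▸ hxy.symm)

/-- The `y`-th number of the `q`-th block of length `L` from `b` on. -/
def blockPos (b L q y : ℕ) : ℕ := b + (q * L + y)

theorem blockPos_inj {b L q q' y y' : ℕ} (hy : y < L) (hy' : y' < L)
    (h : blockPos b L q y = blockPos b L q' y') : q = q' ∧ y = y' := by
  have h' : q * L + y = q' * L + y' := by simpa [blockPos] using h
  have hq : q = q' := by
    have h1 : (q * L + y) / L = q := by
      rw [mul_comm, Nat.mul_add_div (by omega), Nat.div_eq_of_lt hy, add_zero]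
    have h2 : (q' * L + y') / L = q' := by
      rw [mul_comm, Nat.mul_add_div (by omega), Nat.div_eq_of_lt hy', add_zero]
    rw [← h1, h', h2]
  subst hq
  exact ⟨rfl, by omega⟩

/-- Colour a pair of blocks by the adjacencies of the `x i` to the first block and by those between
the two blocks. In a homogeneous family, one edge between blocks would recur for all pairs and give
a biclique between lower and upper blocks. -/
theorem exists_uniform_blocks (t M L h : ℕ) :
    ∃ K, ∀ (H : SimpleGraph ℕ) (x : Fin M → ℕ) (b : ℕ), H.NoBiclique t →
      ∃ T ⊆ Finset.range K, h ≤ T.card ∧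
        (∀ i, ∀ y < L, ∀ q ∈ T, ∀ q' ∈ T, H.Adj (x i) (blockPos b L q y) →
          H.Adj (x i) (blockPos b L q' y)) ∧
        ∀ q ∈ T, ∀ q' ∈ T, q ≠ q' → ∀ y < L, ∀ y' < L,
          ¬ H.Adj (blockPos b L q y) (blockPos b L q' y') := by
  classical
  obtain ⟨K, hK⟩ := exists_homogeneous (Set (Fin M × Fin L) × Set (Fin L × Fin L))
    (h + 2 * t + 1)
  refine ⟨K, fun H x b hH => ?_⟩
  obtain ⟨T, hT, hTc, ⟨k₁, k₂⟩, hk⟩ := hK (fun q q' =>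
    ({p | H.Adj (x p.1) (blockPos b L q p.2)},
      {p | H.Adj (blockPos b L q p.1) (blockPos b L q' p.2)})) (Finset.range K) (by simp)
  have hne : T.Nonempty := Finset.card_pos.1 (by omega)
  have hlt : ∀ q ∈ T.erase (T.max' hne), q ∈ T ∧ q < T.max' hne := fun q hq => by
    obtain ⟨h1, h2⟩ := Finset.mem_erase.1 hq
    exact ⟨h2, lt_of_le_of_ne (T.le_max' q h2) h1⟩
  have hk₁ : ∀ q ∈ T.erase (T.max' hne), ∀ i (y : Fin L),
      H.Adj (x i) (blockPos b L q y) ↔ (i, y) ∈ k₁ := fun q hq i y =>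
    Set.ext_iff.1 (congrArg Prod.fst (hk q (hlt q hq).1 _ (T.max'_mem hne) (hlt q hq).2)) (i, y)
  have hk₂ : ∀ q ∈ T, ∀ q' ∈ T, q < q' → ∀ y y' : Fin L,
      H.Adj (blockPos b L q y) (blockPos b L q' y') ↔ (y, y') ∈ k₂ := fun q hq q' hq' hqq y y' =>
    Set.ext_iff.1 (congrArg Prod.snd (hk q hq q' hq' hqq)) (y, y')
  have hno : ∀ y y' : Fin L, (y, y') ∉ k₂ := by
    intro y y' hyy
    obtain ⟨A, hA, B, hB, hAc, hBc, hAB⟩ := exists_lower_upper t T (by omega)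
    have hinj : ∀ y : Fin L, Function.Injective fun q => blockPos b L q y := fun y q q' hqq =>
      (blockPos_inj y.2 y.2 hqq).1
    obtain ⟨u, hu, v, hv, huv⟩ := hH (A.image fun q => blockPos b L q y)
      (B.image fun q => blockPos b L q y')
      (by rw [Finset.card_image_of_injective _ (hinj y), hAc])
      (by rw [Finset.card_image_of_injective _ (hinj y'), hBc])
    obtain ⟨q, hq, rfl⟩ := Finset.mem_image.1 hu
    obtain ⟨q', hq', rfl⟩ := Finset.mem_image.1 hv
    exact huv ((hk₂ q (hA hq) q' (hB hq') (hAB q hq q' hq') y y').2 hyy)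
  -- The colour sees the `x i` only through the smaller block, so the last block is given up.
  refine ⟨T.erase (T.max' hne), fun q hq => hT (hlt q hq).1, ?_, ?_, ?_⟩
  · rw [Finset.card_erase_of_mem (T.max'_mem hne)]
    omega
  · intro i y hy q hq q' hq' hadj
    exact (hk₁ q' hq' i ⟨y, hy⟩).2 ((hk₁ q hq i ⟨y, hy⟩).1 hadj)
  · intro q hq q' hq' hqq y hy y' hy' hadj
    rcases lt_or_gt_of_ne hqq with hlt' | hlt'
    · exact hno ⟨y, hy⟩ ⟨y', hy'⟩
        ((hk₂ q (hlt q hq).1 q' (hlt q' hq').1 hlt' ⟨y, hy⟩ ⟨y', hy'⟩).1 hadj)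
    · exact hno ⟨y', hy'⟩ ⟨y, hy⟩
        ((hk₂ q' (hlt q' hq').1 q (hlt q hq).1 hlt' ⟨y', hy'⟩ ⟨y, hy⟩).1 hadj.symm)

/-- Shorten the walk through the positions `c` to `y₀` to an induced path. No position beyond `y₀`
is used, which later keeps the path away from vertices whose first neighbour comes after `y₀`. -/
theorem exists_isIndPath_block {b L q c y₀ u v : ℕ} (hcy : c ≤ y₀)
    (hpath : ∀ y, c ≤ y → y < y₀ → H.Adj (blockPos b L q y) (blockPos b L q (y + 1)))
    (hu : H.Adj u (blockPos b L q c)) (hv : H.Adj (blockPos b L q y₀) v) (huv : u ≠ v) :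
    ∃ l, H.IsIndPath (u :: l ++ [v]) ∧
      ∀ x ∈ l, ∃ w, c ≤ w ∧ w ≤ y₀ ∧ x = blockPos b L q w := by
  set S : Set ℕ := {x | x = u ∨ x = v ∨ ∃ w, c ≤ w ∧ w ≤ y₀ ∧ x = blockPos b L q w}
  have hblock : ∀ w, c ≤ w → w ≤ y₀ → blockPos b L q w ∈ S := fun w h1 h2 =>
    .inr (.inr ⟨w, h1, h2, rfl⟩)
  have hreach : ∀ w, c ≤ w → w ≤ y₀ →
      (H.within S).Reachable (blockPos b L q c) (blockPos b L q w) := by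
    intro w hw
    induction w, hw using Nat.le_induction with
    | base => exact fun _ => .refl _
    | succ w hw ih =>
      intro hw'
      have hadj : (H.within S).Adj (blockPos b L q w) (blockPos b L q (w + 1)) :=
        ⟨hpath w hw (by omega), hblock w hw (by omega), hblock _ (by omega) hw'⟩
      exact (ih (by omega)).trans hadj.reachable
  have h1 : (H.within S).Adj u (blockPos b L q c) := ⟨hu, .inl rfl, hblock c le_rfl hcy⟩
  have h2 : (H.within S).Adj (blockPos b L q y₀) v :=
    ⟨hv, hblock y₀ hcy le_rfl, .inr (.inl rfl)⟩
  obtain ⟨p⟩ := (h1.reachable.trans (hreach y₀ hcy le_rfl)).trans h2.reachable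
  obtain ⟨l, hl, hhead, hlast, hS⟩ := exists_isIndPath_of_walk p (.inl rfl)
  obtain ⟨l', rfl⟩ := List.getLast?_eq_some_iff.1 hlast
  cases l' with
  | nil => exact absurd (by simpa using hhead) huv.symm
  | cons a l =>
    obtain rfl : a = u := by simpa using hhead
    refine ⟨l, hl, fun x hx => ?_⟩
    rcases hS x (by simp [hx]) with rfl | rfl | h
    · exact absurd (List.mem_append_left _ hx) hl.notMem
    · have htail : H.IsIndPath (l ++ [x]) := hl.tail
      exfalso
      clear hl hhead hlast hS
      induction l with
      | nil => simp at hx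
      | cons a' l ih =>
        rcases List.mem_cons.1 hx with rfl | hx
        · exact htail.notMem (by simp)
        · exact ih hx htail.tail
    · exact h

/-- A long induced path through independent vertices `z y` and uniform blocks, where `y` is the
first neighbour of `z y` in each block. -/
theorem exists_isIndPath_of_blocks {b L t ℓ : ℕ} (hℓ : ∀ l, H.IsIndPath l → l.length < ℓ)
    {T Y : Finset ℕ} {z : ℕ → ℕ}
    (hpath : ∀ q ∈ T, ∀ y, y + 1 < L → H.Adj (blockPos b L q y) (blockPos b L q (y + 1)))
    (hcross : ∀ q ∈ T, ∀ q' ∈ T, q ≠ q' → ∀ y < L, ∀ y' < L,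
      ¬ H.Adj (blockPos b L q y) (blockPos b L q' y'))
    (hYL : ∀ y ∈ Y, y < L) (hzb : ∀ y ∈ Y, z y < b)
    (hinj : ∀ y ∈ Y, ∀ y' ∈ Y, z y = z y' → y = y')
    (hind : ∀ y ∈ Y, ∀ y' ∈ Y, ¬ H.Adj (z y) (z y'))
    (hfirst : ∀ y ∈ Y, ∀ q ∈ T, H.Adj (z y) (blockPos b L q y))
    (hbefore : ∀ y ∈ Y, ∀ q ∈ T, ∀ w < y, ¬ H.Adj (z y) (blockPos b L q w))
    (hfew : ∀ q ∈ T, ∀ w < L, ∃ F : Finset ℕ, F.card ≤ t ∧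
      ∀ y ∈ Y, H.Adj (z y) (blockPos b L q w) → y ∈ F)
    (k : ℕ) (hT : k ≤ T.card) (hY : k * (ℓ * t + 1) + 1 ≤ Y.card) :
    ∃ (y₀ : ℕ) (p : List ℕ) (Q C : Finset ℕ), y₀ ∈ Y ∧ H.IsIndPath (z y₀ :: p) ∧ k ≤ p.length ∧
      Q ⊆ T ∧ Q.card = k ∧ C ⊆ Y ∧ Y.card ≤ C.card + (k * (ℓ * t + 1) + 1) ∧
      (∀ c ∈ C, c < y₀) ∧
      (∀ v ∈ z y₀ :: p, (∃ y ∈ Y, y₀ ≤ y ∧ v = z y) ∨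
        ∃ q ∈ Q, ∃ w < L, v = blockPos b L q w) ∧
      ∀ c ∈ C, ∀ v ∈ z y₀ :: p, ¬ H.Adj (z c) v := by
  classical
  -- The path grows at its front. `Q` holds the blocks used so far, and `C` the indices below `y₀`
  -- whose vertices have no neighbour on the path.
  induction k with
  | zero =>
    have hne : Y.Nonempty := Finset.card_pos.1 (by omega)
    have hmax := Y.max'_mem hne
    refine ⟨Y.max' hne, [], ∅, Y.erase (Y.max' hne), hmax, isIndPath_singleton _, le_rfl,
      by simp, rfl, Finset.erase_subset _ _, ?_, ?_, ?_, ?_⟩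
    · rw [Finset.card_erase_of_mem hmax]
      omega
    · intro c hc
      obtain ⟨h1, h2⟩ := Finset.mem_erase.1 hc
      exact lt_of_le_of_ne (Y.le_max' c h2) h1
    · intro v hv
      exact .inl ⟨_, hmax, le_rfl, by simpa using hv⟩
    · intro c hc v hv
      obtain rfl : v = z (Y.max' hne) := by simpa using hv
      exact hind c (Finset.mem_of_mem_erase hc) _ hmax
  | succ k ih =>
    rw [Nat.succ_mul] at hY
    obtain ⟨y₀, p, Q, C, hy₀, hp, hlen, hQ, hQc, hC, hCc, hlt, hform, hnadj⟩ :=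
      ih (by omega) (by omega)
    obtain ⟨q, hqT, hqQ⟩ : ∃ q ∈ T, q ∉ Q := Finset.exists_mem_notMem_of_card_lt_card (by omega)
    have hne : C.Nonempty := Finset.card_pos.1 (by omega)
    -- The largest candidate comes next, so the remaining candidates stay below the new front.
    set c := C.max' hne
    have hcC : c ∈ C := C.max'_mem hne
    have hcY := hC hcC
    have hcy := hlt c hcC
    have hy₀L := hYL y₀ hy₀
    obtain ⟨l, hl, hlw⟩ := exists_isIndPath_block (q := q) hcy.le
      (fun y _ h2 => hpath q hqT y (by omega)) (hfirst c hcY q hqT) (hfirst y₀ hy₀ q hqT).symm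
      (fun h => hcy.ne (hinj c hcY y₀ hy₀ h))
    have hllen : l.length ≤ ℓ := by
      have := hℓ _ hl
      simp only [List.length_append, List.length_cons] at this
      omega
    choose! F hFc hF using hfew q hqT
    -- Candidates spoiled by the new segment: at most `t` for each of at most `ℓ` vertices. With `c`
    -- itself, a step costs at most `ℓ * t + 1` candidates. The subtraction recovers the position
    -- within the block.
    let B : Finset ℕ := l.toFinset.biUnion fun v => F (v - blockPos b L q 0)
    have hB : B.card ≤ ℓ * t := by
      refine (Finset.card_biUnion_le_card_mul _ _ t fun v hv => ?_).trans ?_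
      · obtain ⟨w, -, hw, rfl⟩ := hlw v (by simpa using hv)
        have : blockPos b L q w - blockPos b L q 0 = w := by simp only [blockPos]; omega
        rw [this]
        exact hFc w (by omega)
      · exact Nat.mul_le_mul_right t ((List.toFinset_card_le l).trans hllen)
    have hBadj : ∀ y ∈ Y, y ∉ B → ∀ v ∈ l, ¬ H.Adj (z y) v := by
      intro y hy hyB v hv hadj
      refine hyB (Finset.mem_biUnion.2 ⟨v, by simpa using hv, ?_⟩)
      obtain ⟨w, -, hw, rfl⟩ := hlw v hv
      have : blockPos b L q w - blockPos b L q 0 = w := by simp only [blockPos]; omega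
      rw [this]
      exact hF w (by omega) y hy hadj
    have hcomb : H.IsIndPath ((z c :: l) ++ z y₀ :: p) := by
      refine hl.append hp fun x hx v hv => ?_
      have hv0 : v ≠ z y₀ := fun h => hp.notMem (h ▸ hv)
      have hv' := hform v (List.mem_cons_of_mem _ hv)
      rcases List.mem_cons.1 hx with rfl | hx
      · refine ⟨?_, hnadj c hcC v (List.mem_cons_of_mem _ hv)⟩
        rintro rfl
        rcases hv' with ⟨y, hy, hyy, h⟩ | ⟨q', -, w, -, h⟩
        · have := hinj c hcY y hy h
          omega
        · have := hzb c hcY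
          simp only [blockPos] at h
          omega
      · obtain ⟨w, hcw, hw, rfl⟩ := hlw x hx
        rcases hv' with ⟨y, hy, hyy, rfl⟩ | ⟨q', hq', w', hw', rfl⟩
        -- An older `z y` has `y₀ < y`, so its first neighbour in the block lies beyond the segment.
        · have hne' : y ≠ y₀ := fun h => hv0 (by rw [h])
          refine ⟨fun h => ?_, fun h => hbefore y hy q hqT w (by omega) h.symm⟩
          have := hzb y hy
          simp only [blockPos] at h
          omega
        · have hqq : q' ≠ q := fun h => hqQ (h ▸ hq')
          refine ⟨fun h => hqq (blockPos_inj hw' (by omega) h).1,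
            hcross q hqT q' (hQ hq') hqq.symm w (by omega) w' hw'⟩
    refine ⟨c, l ++ z y₀ :: p, insert q Q, (C.erase c) \ B, hcY, hcomb, ?_, ?_, ?_, ?_, ?_, ?_, ?_,
      ?_⟩
    · simp only [List.length_append, List.length_cons]
      omega
    · exact Finset.insert_subset hqT hQ
    · rw [Finset.card_insert_of_notMem hqQ, hQc]
    · exact fun x hx => hC (Finset.mem_of_mem_erase (Finset.mem_sdiff.1 hx).1)
    · have h1 := Finset.le_card_sdiff B (C.erase c)
      rw [Finset.card_erase_of_mem hcC] at h1
      rw [Nat.succ_mul]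
      omega
    · intro x hx
      obtain ⟨h1, h2⟩ := Finset.mem_erase.1 (Finset.mem_sdiff.1 hx).1
      exact lt_of_le_of_ne (C.le_max' x h2) h1
    · intro v hv
      rw [← List.cons_append, List.mem_append] at hv
      rcases hv with hv | hv
      · rcases List.mem_cons.1 hv with rfl | hv
        · exact .inl ⟨c, hcY, le_rfl, rfl⟩
        · obtain ⟨w, -, hw, rfl⟩ := hlw v hv
          exact .inr ⟨q, by simp, w, by omega, rfl⟩
      · rcases hform v hv with ⟨y, hy, hyy, rfl⟩ | ⟨q', hq', h⟩
        · exact .inl ⟨y, hy, by omega, rfl⟩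
        · exact .inr ⟨q', by simp [hq'], h⟩
    · intro x hx v hv
      obtain ⟨hx1, hxB⟩ := Finset.mem_sdiff.1 hx
      have hxC := Finset.mem_of_mem_erase hx1
      rw [← List.cons_append, List.mem_append] at hv
      rcases hv with hv | hv
      · rcases List.mem_cons.1 hv with rfl | hv
        · exact hind x (hC hxC) c hcY
        · exact hBadj x (hC hxC) hxB v hv
      · exact hnadj x hxC v hv

end SimpleGraph

/-! ### Long induced paths and the theorem -/

namespace SimpleGraph

variable {V : Type u} {G : SimpleGraph V}

theorem exists_isIndPath_of_pathOn (t ℓ : ℕ) (ht : 0 < t) :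
    ∃ N, ∀ (H : SimpleGraph ℕ) (a n : ℕ), H.NoBiclique t → H.PathOn a n → N < n →
      ∃ l, H.IsIndPath l ∧ ℓ ≤ l.length := by
  classical
  -- At most `t` vertices share a first position, so `ℓ * (ℓ * t + 1) + 1` distinct positions
  -- remain, enough for `ℓ` steps.
  set M := t * (ℓ * (ℓ * t + 1) + 1) with hM
  obtain ⟨R, hR⟩ := exists_independent t M
  -- The path needs `ℓ` blocks and the bound `hfiber` needs `t`.
  choose K hK using fun L => exists_uniform_blocks t M L (ℓ + t)
  obtain ⟨N, hN⟩ := exists_finset_denseOn ℓ R fun L => K L * L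
  refine ⟨N, fun H a n hH hP hn => ?_⟩
  by_contra hcon
  have hℓ : ∀ l, H.IsIndPath l → l.length < ℓ := fun l hl => by
    by_contra h
    exact hcon ⟨l, hl, not_lt.1 h⟩
  obtain ⟨X, b, m, L, hXc, hab, hbm, hKm, hX⟩ := hN H a n hℓ hP hn
  obtain ⟨X', hX', hXc', hind⟩ := hR H hH X hXc.ge
  obtain ⟨T, hT, hTc, hunif, hcross⟩ := hK L H (X'.orderEmbOfFin hXc') b hH
  set x := X'.orderEmbOfFin hXc' with hx
  have hxX : ∀ i, x i ∈ X' := fun i => Finset.orderEmbOfFin_mem _ _ i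
  have hblock : ∀ q ∈ T, q * L + L ≤ m := fun q hq => by
    rw [← Nat.succ_mul]
    exact (Nat.mul_le_mul_right L (Finset.mem_range.1 (hT hq))).trans hKm
  -- By uniformity, too many neighbours of one position would also be neighbours of that position in
  -- `t` blocks, a biclique.
  have hfiber : ∀ q ∈ T, ∀ w < L,
      (Finset.univ.filter fun i => H.Adj (x i) (blockPos b L q w)).card ≤ t := by
    intro q hq w hw
    by_contra! hlt
    obtain ⟨S, hS, hSc⟩ := Finset.exists_subset_card_eq hlt.le
    obtain ⟨T', hT', hTc'⟩ := Finset.exists_subset_card_eq (show t ≤ T.card by omega)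
    obtain ⟨u, hu, v, hv, huv⟩ := hH (S.image x) (T'.image fun q => blockPos b L q w)
      (by rw [Finset.card_image_of_injective _ x.injective, hSc])
      (by rw [Finset.card_image_of_injective _ fun q q' h => (blockPos_inj hw hw h).1, hTc'])
    obtain ⟨i, hi, rfl⟩ := Finset.mem_image.1 hu
    obtain ⟨q', hq', rfl⟩ := Finset.mem_image.1 hv
    exact huv (hunif i w hw q hq q' (hT' hq') (Finset.mem_filter.1 (hS hi)).2)
  obtain ⟨q₀, hq₀⟩ := Finset.card_pos.1 (show 0 < T.card by omega)
  have hex : ∀ i, ∃ y, y < L ∧ H.Adj (x i) (blockPos b L q₀ y) := by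
    intro i
    obtain ⟨y, h1, h2, h3⟩ := (hX _ (hX' (hxX i))).2 (b + q₀ * L) (by omega)
      (by have := hblock q₀ hq₀; omega)
    refine ⟨y - (b + q₀ * L), by omega, ?_⟩
    rwa [blockPos, show b + (q₀ * L + (y - (b + q₀ * L))) = y by omega]
  let first : Fin M → ℕ := fun i => Nat.find (hex i)
  have hfirst : ∀ i, first i < L ∧ H.Adj (x i) (blockPos b L q₀ (first i)) := fun i =>
    Nat.find_spec (hex i)
  set Y := Finset.univ.image first with hY
  have hYc : ℓ * (ℓ * t + 1) + 1 ≤ Y.card := by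
    have h1 : (Finset.univ : Finset (Fin M)).card ≤ t * Y.card := by
      refine Finset.card_le_mul_card_image _ t fun w hw => ?_
      obtain ⟨i, -, rfl⟩ := Finset.mem_image.1 hw
      refine (Finset.card_le_card fun j hj => ?_).trans (hfiber q₀ hq₀ (first i) (hfirst i).1)
      have hji := (Finset.mem_filter.1 hj).2
      exact Finset.mem_filter.2 ⟨Finset.mem_univ _, hji ▸ (hfirst j).2⟩
    rw [Finset.card_univ, Fintype.card_fin, hM] at h1
    exact Nat.le_of_mul_le_mul_left h1 ht
  have hsurj : ∀ y ∈ Y, ∃ i, first i = y := fun y hy => by simpa [hY] using hy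
  have hM0 : 0 < M := Nat.mul_pos ht (Nat.succ_pos _)
  have : Nonempty (Fin M) := ⟨⟨0, hM0⟩⟩
  choose! idx hidx using hsurj
  obtain ⟨y₀, p, -, -, -, hp, hlen, -⟩ := exists_isIndPath_of_blocks (H := H) (b := b) (L := L)
    (t := t) (ℓ := ℓ) hℓ (T := T) (Y := Y) (z := fun y => x (idx y))
    (fun q hq y hy => hP _ (by simp only [blockPos]; omega)
      (by have := hblock q hq; simp only [blockPos]; omega))
    hcross
    (fun y hy => hidx y hy ▸ (hfirst (idx y)).1)
    (fun y _ => (hX _ (hX' (hxX _))).1)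
    (fun y hy y' hy' h => by rw [← hidx y hy, ← hidx y' hy', x.injective h])
    (fun y _ y' _ => hind _ (hxX _) _ (hxX _))
    (fun y hy q hq => by
      have h := hfirst (idx y)
      rw [hidx y hy] at h
      exact hunif _ y h.1 q₀ hq₀ q hq h.2)
    (fun y hy q hq w hw hadj => by
      have hwL : w < L := hw.trans (hidx y hy ▸ (hfirst (idx y)).1)
      refine Nat.find_min (hex (idx y)) (m := w) ?_ ⟨hwL, hunif _ w hwL q hq q₀ hq₀ hadj⟩
      rw [← hidx y hy] at hw
      exact hw)
    (fun q hq w hw => ⟨_, Finset.card_image_le.trans (hfiber q hq w hw), fun y hy hadj =>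
      Finset.mem_image.2 ⟨idx y, Finset.mem_filter.2 ⟨Finset.mem_univ _, hadj⟩, hidx y hy⟩⟩)
    ℓ (by omega) hYc
  have := hℓ _ hp
  simp only [List.length_cons] at this
  omega

variable (G) in
/-- The graph that `G` induces on the positions of a list of vertices. -/
def onPositions (l : List V) : SimpleGraph ℕ where
  Adj i j := ∃ (hi : i < l.length) (hj : j < l.length), G.Adj l[i] l[j]
  symm := ⟨fun _ _ ⟨hi, hj, h⟩ => ⟨hj, hi, h.symm⟩⟩
  loopless := ⟨fun _ ⟨_, _, h⟩ => h.ne rfl⟩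

theorem noBiclique_onPositions {t : ℕ} (ht : 0 < t)
    (hG : (completeBipartiteGraph (Fin t) (Fin t)).Free G) {l : List V} (hl : l.Nodup) :
    (G.onPositions l).NoBiclique t := by
  intro S T hS hT
  by_contra! hadj
  obtain ⟨s₀, hs₀⟩ := Finset.card_pos.1 (hS ▸ ht)
  obtain ⟨t₀, ht₀⟩ := Finset.card_pos.1 (hT ▸ ht)
  have hSl : ∀ a ∈ S, a < l.length := fun a ha => (hadj a ha t₀ ht₀).1
  have hTl : ∀ b ∈ T, b < l.length := fun b hb => (hadj s₀ hs₀ b hb).2.1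
  let eS := S.orderEmbOfFin hS
  let eT := T.orderEmbOfFin hT
  have heS : ∀ i, eS i ∈ S := fun i => Finset.orderEmbOfFin_mem _ _ i
  have heT : ∀ i, eT i ∈ T := fun i => Finset.orderEmbOfFin_mem _ _ i
  let g : Fin t ⊕ Fin t → V := Sum.elim (fun i => l[eS i]'(hSl _ (heS i)))
    fun i => l[eT i]'(hTl _ (heT i))
  have hST : ∀ i j, G.Adj (g (.inl i)) (g (.inr j)) := fun i j => (hadj _ (heS i) _ (heT j)).2.2
  refine hG ⟨⟨⟨g, fun {u v} huv => ?_⟩, fun u v huv => ?_⟩⟩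
  · rcases u with i | i <;> rcases v with j | j
    · simp at huv
    · exact hST i j
    · exact (hST j i).symm
    · simp at huv
  · change g u = g v at huv
    rcases u with i | i <;> rcases v with j | j
    · exact congrArg _ (eS.injective ((hl.getElem_inj_iff).1 huv))
    · exact absurd huv (hST i j).ne
    · exact absurd huv (hST j i).ne'
    · exact congrArg _ (eT.injective ((hl.getElem_inj_iff).1 huv))

/-- The theorem of Galvin, Rival and Sands: a graph with a long path contains a large complete
bipartite subgraph or a long induced path. -/
theorem exists_pathGraph_isIndContained (t ℓ : ℕ) (ht : 0 < t) :
    ∃ N, ∀ (V : Type u) (G : SimpleGraph V),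
      (completeBipartiteGraph (Fin t) (Fin t)).Free G → ∀ l : List V, l.Nodup →
      l.IsChain G.Adj → N < l.length → (pathGraph ℓ).IsIndContained G := by
  -- With at least two vertices on the induced path, each has a neighbour and is therefore a genuine
  -- position of `l`. The surplus is cut off by `take`.
  obtain ⟨N, hN⟩ := exists_isIndPath_of_pathOn t (ℓ + 2) ht
  refine ⟨N, fun V G hG l hl hc hlen => ?_⟩
  obtain ⟨p, hp, hplen⟩ := hN (G.onPositions l) 0 l.length (noBiclique_onPositions ht hG hl)
    (fun i _ hi => ⟨by omega, by omega, List.isChain_iff_getElem.1 hc i (by omega)⟩) hlen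
  have hlt : ∀ x ∈ p, x < l.length := by
    match p, hp, hplen with
    | a :: b :: p, hp, _ =>
      intro x hx
      obtain ⟨y, hxl, -⟩ := hp.exists_adj x hx
      exact hxl
  have hne : l ≠ [] := by rintro rfl; simp at hlen
  have hg : ∀ i (h : i < l.length), l.getD i (l.head hne) = l[i] := fun i h =>
    List.getD_eq_getElem _ _ h
  have hp' : G.IsIndPath (p.map fun i => l.getD i (l.head hne)) := by
    refine hp.map _ (fun x hx y hy hxy => ?_) fun x hx y hy => ?_
    · rw [hg x (hlt x hx), hg y (hlt y hy)] at hxy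
      exact (hl.getElem_inj_iff).1 hxy
    · rw [hg x (hlt x hx), hg y (hlt y hy)]
      exact ⟨fun h => ⟨hlt x hx, hlt y hy, h⟩, fun ⟨_, _, h⟩ => h⟩
  have h := (hp'.take ℓ).isIndContained
  rwa [List.length_take, List.length_map, min_eq_left (by omega)] at h

theorem exists_isInducedPathBound (t ℓ : ℕ) (ht : 0 < t) :
    ∃ c, IsInducedPathBound.{u} t t ℓ c := by
  obtain ⟨N, hN⟩ := exists_pathGraph_isIndContained.{u} t ℓ ht
  refine ⟨N + 1, fun V _ G hG hc => ?_⟩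
  by_contra hcon
  have h : G.treedepth ≤ N := treedepth_le_of_forall_isChain fun l hl hlc => by
    by_contra! hlen
    exact hcon (hN V G hG l hl hlc hlen)
  have := hc.trans h
  norm_cast at this
  omega

theorem cycleGraph_eight_isContained_completeBipartiteGraph :
    (cycleGraph 8).IsContained (completeBipartiteGraph (Fin 4) (Fin 4)) := by
  let g : Fin 8 → Fin 4 ⊕ Fin 4 :=
    ![.inl 0, .inr 0, .inl 1, .inr 1, .inl 2, .inr 2, .inl 3, .inr 3]
  have h : ∀ i j : Fin 8, (i - j = 1 ∨ j - i = 1) →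
      ((g i).isLeft ∧ (g j).isRight ∨ (g i).isRight ∧ (g j).isLeft) := by decide
  have hinj : ∀ i j : Fin 8, g i = g j → i = j := by decide
  exact ⟨⟨⟨g, fun {i j} hij => h i j (cycleGraph_adj.1 hij)⟩, fun {i j} => hinj i j⟩⟩

theorem treedepth_lt_of_isInducedPathBound {ℓ c : ℕ} (hℓ : 14 ≤ ℓ)
    (hc : IsInducedPathBound.{u} 4 4 ℓ c) [Finite V] (hG : (cycleGraph 8).Free G)
    (hd : G.ediam ≤ 3) : G.treedepth < c := by
  by_contra! h
  have hfree : (completeBipartiteGraph (Fin 4) (Fin 4)).Free G := fun h' =>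
    hG (cycleGraph_eight_isContained_completeBipartiteGraph.trans h')
  exact hG (cycleGraph_eight_isContained_of_ediam_le_three hd hℓ (hc V G hfree h))

end SimpleGraph

theorem mainTheorem4 :
    (∃ N : ℕ, ∀ (V : Type u) [Finite V] (G : SimpleGraph V),
      (SimpleGraph.cycleGraph 8).Free G → G.ediam ≤ 3 → G.treedepth ≤ (N : ℕ∞)) ∧
    (∃ c : ℕ, SimpleGraph.IsInducedPathBound.{u} 4 4 42 c) ∧
    (∀ c : ℕ, SimpleGraph.IsInducedPathBound.{u} 4 4 42 c →
      ∀ (V : Type u) [Finite V] (G : SimpleGraph V),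
        (SimpleGraph.cycleGraph 8).Free G → G.ediam ≤ 3 → G.treedepth < (c : ℕ∞)) := by
  obtain ⟨c, hc⟩ := SimpleGraph.exists_isInducedPathBound.{u} 4 42 (by norm_num)
  exact ⟨⟨c, fun V _ G hG hd =>
      (SimpleGraph.treedepth_lt_of_isInducedPathBound (by norm_num) hc hG hd).le⟩, ⟨c, hc⟩,
    fun c hc V _ G hG hd => SimpleGraph.treedepth_lt_of_isInducedPathBound (by norm_num) hc hG hd⟩
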